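/- Let $D\subset\mathbb{R}^d$ be compact, let $B$ be a linear subspace of the space $C(D)$ of continuous real functions on $D$ (the path space), with the $\sigma$-algebra generated by the point evaluations (equivalently, the Borel $\sigma$-algebra of the sup norm), and let $T:B\to\mathbb{R}^D$ be a linear operator such that $f\mapsto T(f)(\mathbf{x})$ is measurable for every $\mathbf{x}\in D$ (this holds in particular if $T$ is bounded, for instance from $B=C(D)$ to $C(D)$ with the sup norm). A function $f:D\to\mathbb{R}$ is called $T$-invariant if $f\in B$ and $T(f)=f$; a kernel $k:D\times D\to\mathbb{R}$ is called argumentwise $T$-invariant if $k(\mathbf{x},\cdot)$ is $T$-invariant for every $\mathbf{x}\in D$; a random field $W$ with paths in $B$, defined on a probability space $(\Omega',\mathbb{P}')$, is called $T$-invariant up to a modification if $\mathbb{P}'(T(W)_{\mathbf{x}}=W_{\mathbf{x}})=1$ for every $\mathbf{x}\in D$. Let $Z=(Z_{\mathbf{x}})_{\mathbf{x}\in D}$ be a centred Gaussian random field with paths in $B$, whose covariance kernel $k$ is argumentwise $T$-invariant. Let $\mathbf{x}^{(1)},\dots,\mathbf{x}^{(n)}\in D$ be such that the matrix $K=(k(\mathbf{x}^{(i)},\mathbf{x}^{(j)}))_{1\le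 i,j\le n}$ is invertible, put $\mathbf{k}(\mathbf{x})=(k(\mathbf{x},\mathbf{x}^{(i)}))_{1\le i\le n}$, and for $\mathbf{y}\in\mathbb{R}^n$ let $$m_{\mathbf{y}}(\mathbf{x})=\mathbf{k}(\mathbf{x})^{t}K^{-1}\mathbf{y},\qquad c(\mathbf{x},\mathbf{x}')=k(\mathbf{x},\mathbf{x}')-\mathbf{k}(\mathbf{x})^{t}K^{-1}\mathbf{k}(\mathbf{x}')$$ be the Gaussian process regression (kriging) mean predictor for the observed values $\mathbf{y}$ and the conditional covariance kernel. Then: (i) for every $\mathbf{y}\in\mathbb{R}^n$ the predictor $m_{\mathbf{y}}$ is $T$-invariant; (ii) the conditional covariance kernel $c$ is argumentwise $T$-invariant; (iii) $Z$ conditioned on the observations $Z(\mathbf{X})=(Z_{\mathbf{x}^{(1)}},\dots,Z_{\mathbf{x}^{(n)}})$ is $T$-invariant up to a modification. Precisely, there is a regular conditional distribution $(\kappa_{\mathbf{y}})_{\mathbf{y}\in\mathbb{R}^n}$ on $B$ of $Z$ given $Z(\mathbf{X})$ such that, for every $\mathbf{y}\in\mathbb{R}^n$, $\kappa_{\mathbf{y}}$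 is the law of a Gaussian field with mean $m_{\mathbf{y}}$ and covariance kernel $c$, and this field is $T$-invariant up to a modification; and for every regular conditional distribution $(\kappa_{\mathbf{y}})$ on $B$ of $Z$ given $Z(\mathbf{X})$, for almost every $\mathbf{y}$ with respect to the law of $Z(\mathbf{X})$, a random field with law $\kappa_{\mathbf{y}}$ is $T$-invariant up to a modification. Consequently, conditional simulations are $T$-invariant: for every $\mathbf{y}\in\mathbb{R}^n$, every Gaussian random field with paths in $B$, mean $m_{\mathbf{y}}$ and covariance kernel $c$, on any probability space, is $T$-invariant up to a modification. -/

import Mathlib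

open MeasureTheory ProbabilityTheory
open scoped Matrix

noncomputable section

/-- A space of continuous paths on `D` carries the cylinder σ-algebra, i.e. the one generated by
the point evaluations. -/
instance pathMeasurableSpace {d : ℕ} {D : Set (EuclideanSpace ℝ (Fin d))}
    (B : Submodule ℝ C(D, ℝ)) : MeasurableSpace B :=
  MeasurableSpace.comap (fun (f : B) (x : D) => (f : C(D, ℝ)) x) MeasurableSpace.pi

/-- The random field `Z`, with paths in `B`, is Gaussian with mean function `m` and
covariance kernel `k`. -/
structure IsGaussianField {d : ℕ} {D : Set (EuclideanSpace ℝ (Fin d))}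
    {B : Submodule ℝ C(D, ℝ)} {Ω : Type*} [MeasurableSpace Ω] (P : Measure Ω)
    (Z : Ω → B) (m : D → ℝ) (k : D → D → ℝ) : Prop where
  measurable : Measurable Z
  gaussian : IsGaussianProcess (fun (x : D) (ω : Ω) => (Z ω : C(D, ℝ)) x) P
  mean_eq : ∀ x : D, ∫ ω, (Z ω : C(D, ℝ)) x ∂P = m x
  cov_eq : ∀ x x' : D,
    covariance (fun ω => (Z ω : C(D, ℝ)) x) (fun ω => (Z ω : C(D, ℝ)) x') P = k x x'

/-- The function `f` is `T`-invariant: it belongs to the domain `B` of `T`, and `T f = f`. -/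
def IsInvariantFun {d : ℕ} {D : Set (EuclideanSpace ℝ (Fin d))} {B : Submodule ℝ C(D, ℝ)}
    (T : B →ₗ[ℝ] (D → ℝ)) (f : D → ℝ) : Prop :=
  ∃ g : B, (∀ x : D, (g : C(D, ℝ)) x = f x) ∧ T g = f

/-- The kernel `k` is argumentwise `T`-invariant: every `k(x, ·)` is `T`-invariant. -/
def IsArgInvariant {d : ℕ} {D : Set (EuclideanSpace ℝ (Fin d))} {B : Submodule ℝ C(D, ℝ)}
    (T : B →ₗ[ℝ] (D → ℝ)) (k : D → D → ℝ) : Prop :=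
  ∀ x : D, IsInvariantFun T (k x)

/-- The random field `Z` is `T`-invariant up to a modification:
`P (T(Z)_x = Z_x) = 1` for every `x`. -/
def IsInvariantField {d : ℕ} {D : Set (EuclideanSpace ℝ (Fin d))} {B : Submodule ℝ C(D, ℝ)}
    (T : B →ₗ[ℝ] (D → ℝ)) {Ω : Type*} [MeasurableSpace Ω] (P : Measure Ω) (Z : Ω → B) : Prop :=
  ∀ x : D, ∀ᵐ ω ∂P, T (Z ω) x = (Z ω : C(D, ℝ)) x

/-- The Gram matrix `K = (k(xᵢ, xⱼ))`. -/
def gramMat {ι : Type*} {n : ℕ} (k : ι → ι → ℝ) (X : Fin n → ι) : Matrix (Fin n) (Fin n) ℝ :=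
  Matrix.of fun i j => k (X i) (X j)

/-- The vector `𝐤(x) = (k(x, xᵢ))`. -/
def kernelVec {ι : Type*} {n : ℕ} (k : ι → ι → ℝ) (X : Fin n → ι) (x : ι) : Fin n → ℝ :=
  fun i => k x (X i)

/-- The GPR (kriging) mean predictor `m(x) = 𝐤(x)ᵗ K⁻¹ y`. -/
def gprMean {ι : Type*} {n : ℕ} (k : ι → ι → ℝ) (X : Fin n → ι) (y : Fin n → ℝ) (x : ι) : ℝ :=
  kernelVec k X x ⬝ᵥ ((gramMat k X)⁻¹ *ᵥ y)

/-- The conditional covariance kernel `c(x, x') = k(x, x') - 𝐤(x)ᵗ K⁻¹ 𝐤(x')`. -/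
def gprCov {ι : Type*} {n : ℕ} (k : ι → ι → ℝ) (X : Fin n → ι) (x x' : ι) : ℝ :=
  k x x' - kernelVec k X x ⬝ᵥ ((gramMat k X)⁻¹ *ᵥ kernelVec k X x')

/-- The vector `(Z(x₁), …, Z(xₙ))` of observations. -/
def obsVec {d : ℕ} {D : Set (EuclideanSpace ℝ (Fin d))} {B : Submodule ℝ C(D, ℝ)}
    {Ω : Type*} {n : ℕ} (Z : Ω → B) (X : Fin n → D) (ω : Ω) : Fin n → ℝ :=
  fun i => (Z ω : C(D, ℝ)) (X i)

end

/-!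
# Invariance of Gaussian process regression under a linear operator

The heart of the matter is a zero-one law, `IsGaussianField.ae_linear_eq_zero`: for a centred
Gaussian field `Z` with kernel `k` and paths in `B`, a measurable linear functional `ℓ` on `B` with
`ℓ (k(x, ·)) = 0` for all `x` satisfies `ℓ Z = 0` almost surely. No continuity of `ℓ` and no
regularity of `B` is available, so the argument avoids any integral representation of `ℓ`.
Given finitely many points, the kriging residual `R = Z - 𝐤ᵗ A Z(X)`, with `A` a generalized inverse
of the Gram matrix, is jointly Gaussian with and uncorrelated to `Z(X)`, hence independent of it
(`IsGaussianField.indepFun_residual_obsVec`). The difference `Z - R` is a combination of the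
functions `k(xᵢ, ·)`, so `ℓ Z = ℓ R` is independent of `Z(X)`. The points being arbitrary, `ℓ Z` is
independent of the whole path `Z`, thus of itself. Its law is moreover symmetric, because `Z` and
`-Z` have the same law; so `ℓ Z` is null.

Applied to `ℓ f = T f x - f x` and to the centred field, this shows that a Gaussian field with
invariant mean and argumentwise invariant covariance kernel is invariant up to a modification
(`IsGaussianField.isInvariantField`). The kriging mean and the conditional kernel are linear
combinations of functions `k(x, ·)`, so they inherit invariance by linearity of `T`.

For an invertible Gram matrix the decomposition `Z = R + m_{Z(X)}` also yields the conditional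
distribution: the law of `R + m_y`, which is Gaussian with mean `m_y` and covariance `c`. Any other
version agrees with it for almost every `y`, since the σ-algebra of the path space is countably
generated (`pathCountablyGenerated`).
-/

/-! ### The cylinder σ-algebra of the path space -/

section PathSpace

variable {d : ℕ} {D : Set (EuclideanSpace ℝ (Fin d))} {B : Submodule ℝ C(D, ℝ)}

lemma measurable_pathEval (x : D) : Measurable (fun f : B => (f : C(D, ℝ)) x) :=
  (measurable_pi_apply x).comp (comap_measurable _)

lemma measurable_path_iff {α : Type*} [MeasurableSpace α] {F : α → B} :
    Measurable F ↔ ∀ x : D, Measurable fun a => (F a : C(D, ℝ)) x := by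
  rw [measurable_comap_iff, measurable_pi_iff]
  rfl

/-- Paths being continuous, the evaluations on a countable dense subset of `D` already generate the
cylinder σ-algebra. -/
instance pathCountablyGenerated : MeasurableSpace.CountablyGenerated B := by
  obtain ⟨S, hSc, hSd⟩ := TopologicalSpace.exists_countable_dense D
  have := hSc.to_subtype
  have key : pathMeasurableSpace B =
      MeasurableSpace.comap (fun (f : B) (s : S) => (f : C(D, ℝ)) s) MeasurableSpace.pi := by
    apply le_antisymm
    · let m' := MeasurableSpace.comap (fun (f : B) (s : S) => (f : C(D, ℝ)) s) MeasurableSpace.pi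
      refine measurable_iff_comap_le.1 (measurable_pi_iff.2 fun x => ?_)
      obtain ⟨u, huS, hux⟩ := mem_closure_iff_seq_limit.1 (hSd x)
      refine measurable_of_tendsto_metrizable (f := fun n (f : B) => (f : C(D, ℝ)) (u n))
        (fun n => ?_) (tendsto_pi_nhds.2 fun f => ?_)
      · exact (measurable_pi_apply (⟨u n, huS n⟩ : S)).comp
          (comap_measurable (fun (f : B) (s : S) => (f : C(D, ℝ)) s))
      · exact ((f : C(D, ℝ)).continuous.tendsto x).comp hux
    · exact measurable_iff_comap_le.1 (measurable_pi_iff.2 fun s => measurable_pathEval _)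
  rw [key]
  exact MeasurableSpace.CountablyGenerated.comap _

/-- The law of a random path is determined by the law of the process of
evaluations. -/
lemma map_path_eq_of_map_process_eq {Ω : Type*} [MeasurableSpace Ω] {P : Measure Ω}
    {Z W : Ω → B} (hZ : Measurable Z) (hW : Measurable W)
    (h : P.map (fun ω (x : D) => (Z ω : C(D, ℝ)) x) = P.map (fun ω (x : D) => (W ω : C(D, ℝ)) x)) :
    P.map Z = P.map W := by
  ext s hs
  obtain ⟨t, ht, rfl⟩ := hs
  have hZ' : Measurable (fun ω (x : D) => (Z ω : C(D, ℝ)) x) :=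
    measurable_pi_iff.2 (measurable_path_iff.1 hZ)
  have hW' : Measurable (fun ω (x : D) => (W ω : C(D, ℝ)) x) :=
    measurable_pi_iff.2 (measurable_path_iff.1 hW)
  rw [Measure.map_apply hZ ⟨t, ht, rfl⟩, Measure.map_apply hW ⟨t, ht, rfl⟩]
  have := congrArg (fun μ => μ t) h
  simpa only [Measure.map_apply hZ' ht, Measure.map_apply hW' ht] using! this

end PathSpace

/-! ### Symmetry of centred Gaussian measures -/

section Symmetry

lemma ProbabilityTheory.IsGaussian.map_neg_eq_self {E : Type*} [NormedAddCommGroup E]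
    [NormedSpace ℝ E] [MeasurableSpace E] [BorelSpace E] [SecondCountableTopology E]
    [CompleteSpace E] {μ : Measure E} [IsGaussian μ] (h : ∫ x, x ∂μ = 0) :
    μ.map (fun x => -x) = μ := by
  have h0 (L : StrongDual ℝ E) : ∫ x, (L x) ∂μ = 0 := by
    rw [IsGaussian.integral_dual, h, map_zero]
  refine Measure.ext_of_charFunDual ?_
  ext L
  have h1 : charFunDual (μ.map (fun x => -x)) L = charFunDual μ (-L) := by
    rw [charFunDual_apply, charFunDual_apply, integral_map (by fun_prop) (by fun_prop)]
    simp
  rw [h1, IsGaussian.charFunDual_eq, IsGaussian.charFunDual_eq, integral_complex_ofReal,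
    integral_complex_ofReal, h0, h0]
  congr 4
  exact variance_neg

end Symmetry

/-! ### Gaussian fields: translation, image measure, symmetry -/

section GaussianField

variable {d : ℕ} {D : Set (EuclideanSpace ℝ (Fin d))} {B : Submodule ℝ C(D, ℝ)}
  {Ω : Type*} [MeasurableSpace Ω] {P : Measure Ω} {Z : Ω → B} {m : D → ℝ} {k : D → D → ℝ}

namespace IsGaussianField

lemma isProbabilityMeasure (hZ : IsGaussianField P Z m k) : IsProbabilityMeasure P :=
  hZ.gaussian.isProbabilityMeasure

lemma measurable_eval (hZ : IsGaussianField P Z m k) (x : D) :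
    Measurable fun ω => (Z ω : C(D, ℝ)) x :=
  measurable_path_iff.1 hZ.measurable x

lemma memLp_two (hZ : IsGaussianField P Z m k) (x : D) :
    MemLp (fun ω => (Z ω : C(D, ℝ)) x) 2 P :=
  (hZ.gaussian.hasGaussianLaw_eval x).memLp_two

lemma integrable (hZ : IsGaussianField P Z m k) (x : D) :
    Integrable (fun ω => (Z ω : C(D, ℝ)) x) P :=
  (hZ.gaussian.hasGaussianLaw_eval x).integrable

lemma cov_comm (hZ : IsGaussianField P Z m k) (x x' : D) : k x x' = k x' x := by
  rw [← hZ.cov_eq, ← hZ.cov_eq, covariance_comm]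

/-- Being a Gaussian field only depends on the law of the random path. -/
lemma map_iff {W : Ω → B} (hW : Measurable W) :
    IsGaussianField (P.map W) (fun f : B => f) m k ↔ IsGaussianField P W m k := by
  have hlaw (I : Finset D) : (P.map W).map (fun f : B => I.restrict fun x : D => (f : C(D, ℝ)) x)
      = P.map fun ω => I.restrict fun x : D => (W ω : C(D, ℝ)) x := by
    have hm : Measurable fun f : B => I.restrict fun x : D => (f : C(D, ℝ)) x :=
      measurable_pi_iff.2 fun x => measurable_pathEval _
    rw [Measure.map_map hm hW]
    rfl
  have hmean (x : D) : ∫ f : B, (f : C(D, ℝ)) x ∂(P.map W) = ∫ ω, (W ω : C(D, ℝ)) x ∂P :=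
    integral_map hW.aemeasurable (measurable_pathEval x).aestronglyMeasurable
  have hcov (x x' : D) : covariance (fun f : B => (f : C(D, ℝ)) x) (fun f : B => (f : C(D, ℝ)) x')
      (P.map W) = covariance (fun ω => (W ω : C(D, ℝ)) x) (fun ω => (W ω : C(D, ℝ)) x') P :=
    covariance_map_fun (measurable_pathEval x).aestronglyMeasurable
      (measurable_pathEval x').aestronglyMeasurable hW.aemeasurable
  constructor
  · intro h
    refine ⟨hW, ⟨fun I => ⟨?_⟩⟩, fun x => ?_, fun x x' => ?_⟩
    · rw [← hlaw]
      exact (h.gaussian.hasGaussianLaw I).isGaussian_map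
    · rw [← hmean, h.mean_eq]
    · rw [← hcov, h.cov_eq]
  · intro h
    refine ⟨measurable_id, ⟨fun I => ⟨?_⟩⟩, fun x => ?_, fun x x' => ?_⟩
    · rw [hlaw]
      exact (h.gaussian.hasGaussianLaw I).isGaussian_map
    · rw [hmean, h.mean_eq]
    · rw [hcov, h.cov_eq]

lemma add_const (hZ : IsGaussianField P Z m k) (g : B) :
    IsGaussianField P (fun ω => Z ω + g) (fun x => m x + (g : C(D, ℝ)) x) k := by
  have := hZ.isProbabilityMeasure
  refine ⟨?_, ⟨fun I => ⟨?_⟩⟩, fun x => ?_, fun x x' => ?_⟩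
  · refine measurable_path_iff.2 fun x => ?_
    simpa using (hZ.measurable_eval x).add_const _
  · have := (hZ.gaussian.hasGaussianLaw I).isGaussian_map
    have h2 : P.map (fun ω => I.restrict fun x : D => ((Z ω + g : B) : C(D, ℝ)) x) =
        (P.map fun ω => I.restrict fun x : D => (Z ω : C(D, ℝ)) x).map
          (fun y => y + I.restrict fun x : D => (g : C(D, ℝ)) x) := by
      have hm : Measurable fun ω => I.restrict fun x : D => (Z ω : C(D, ℝ)) x :=
        measurable_pi_iff.2 fun x => hZ.measurable_eval _
      rw [Measure.map_map (by fun_prop) hm]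
      rfl
    rw [h2]
    infer_instance
  · simp [integral_add (hZ.integrable x) (integrable_const _), hZ.mean_eq]
  · have h := hZ.cov_eq x x'
    simpa [covariance_add_const_left (hZ.integrable x),
      covariance_add_const_right (hZ.integrable x')] using h

/-- Centred Gaussian fields are symmetric. -/
lemma map_neg_eq (hZ : IsGaussianField P Z (fun _ => 0) k) :
    P.map (fun ω => -Z ω) = P.map Z := by
  have := hZ.isProbabilityMeasure
  have hneg : Measurable fun ω => -Z ω :=
    measurable_path_iff.2 fun x => (hZ.measurable_eval x).neg
  refine map_path_eq_of_map_process_eq hneg hZ.measurable ?_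
  refine (map_eq_iff_forall_finset_map_restrict_eq
    (measurable_pi_iff.2 (measurable_path_iff.1 hneg)).aemeasurable
    (measurable_pi_iff.2 (measurable_path_iff.1 hZ.measurable)).aemeasurable).2 fun I => ?_
  have hG := (hZ.gaussian.hasGaussianLaw I).isGaussian_map
  have hm : Measurable fun ω => I.restrict fun x : D => (Z ω : C(D, ℝ)) x :=
    measurable_pi_iff.2 fun x => hZ.measurable_eval _
  have h0 : ∫ y, y ∂(P.map fun ω => I.restrict fun x : D => (Z ω : C(D, ℝ)) x) = 0 := by
    rw [integral_map hm.aemeasurable (by fun_prop)]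
    ext i
    rw [eval_integral (f := fun ω => I.restrict fun x : D => (Z ω : C(D, ℝ)) x)
      fun i => hZ.integrable _]
    exact hZ.mean_eq _
  rw [← IsGaussian.map_neg_eq_self h0, Measure.map_map (by fun_prop) hm]
  rfl

end IsGaussianField

end GaussianField

/-! ### Generalized inverses -/

lemma Matrix.exists_mul_mul_eq_self {𝕜 ι : Type*} [Field 𝕜] [Fintype ι] [DecidableEq ι]
    (K : Matrix ι ι 𝕜) : ∃ A : Matrix ι ι 𝕜, K * A * K = K := by
  obtain ⟨g, hg⟩ := K.mulVecLin.rangeRestrict.exists_rightInverse_of_surjective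
    (LinearMap.range_rangeRestrict _)
  obtain ⟨h, hh⟩ := g.exists_extend
  refine ⟨LinearMap.toMatrix' h, ?_⟩
  refine Matrix.ext_of_mulVec_single fun i => ?_
  have h1 (v : ι → 𝕜) : h (K *ᵥ v) = g (K.mulVecLin.rangeRestrict v) :=
    LinearMap.congr_fun hh (K.mulVecLin.rangeRestrict v)
  have h2 (w : LinearMap.range K.mulVecLin) : K *ᵥ g w = w :=
    congrArg Subtype.val (LinearMap.congr_fun hg w)
  rw [← Matrix.mulVec_mulVec, ← Matrix.mulVec_mulVec, LinearMap.toMatrix'_mulVec, h1, h2]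
  rfl

/-! ### Kriging paths and kriging residuals -/

section Kriging

variable {d : ℕ} {D : Set (EuclideanSpace ℝ (Fin d))} {B : Submodule ℝ C(D, ℝ)}
  {Ω : Type*} [MeasurableSpace Ω] {P : Measure Ω} {Z : Ω → B} {m : D → ℝ} {k : D → D → ℝ}
  {n : ℕ} {X : Fin n → D}

/-- The path `x ↦ 𝐤(x)ᵗ A y` as an element of the path space `B`, linear in the observed values `y`.
Here `g i` is the path `k(xᵢ, ·)`, and `A` stands for the inverse of the Gram matrix, or for a
generalized inverse if there is none. -/
noncomputable def krigingPath (g : Fin n → B) (A : Matrix (Fin n) (Fin n) ℝ) :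
    (Fin n → ℝ) →ₗ[ℝ] B :=
  Fintype.linearCombination ℝ g ∘ₗ A.mulVecLin

lemma krigingPath_apply {g : Fin n → B} (A : Matrix (Fin n) (Fin n) ℝ)
    (hg : ∀ i x, (g i : C(D, ℝ)) x = k x (X i)) (y : Fin n → ℝ) (x : D) :
    (krigingPath g A y : C(D, ℝ)) x = kernelVec k X x ⬝ᵥ (A *ᵥ y) := by
  simp [krigingPath, Fintype.linearCombination_apply, kernelVec, dotProduct, hg, mul_comm]

lemma measurable_krigingPath (g : Fin n → B) (A : Matrix (Fin n) (Fin n) ℝ) :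
    Measurable (krigingPath g A) := by
  refine measurable_path_iff.2 fun x => ?_
  let L : (Fin n → ℝ) →ₗ[ℝ] ℝ :=
    { toFun := fun y => (krigingPath g A y : C(D, ℝ)) x
      map_add' := by simp
      map_smul' := by simp }
  exact (LinearMap.continuous_of_finiteDimensional L).measurable

namespace IsGaussianField

lemma measurable_obsVec (hZ : IsGaussianField P Z m k) (X : Fin n → D) :
    Measurable (obsVec Z X) :=
  measurable_pi_iff.2 fun _ => hZ.measurable_eval _

lemma cov_sum_right (hZ : IsGaussianField P Z m k) (X : Fin n → D) (w : Fin n → ℝ) {U : Ω → ℝ}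
    (hU : MemLp U 2 P) :
    covariance U (fun ω => ∑ j, w j * (Z ω : C(D, ℝ)) (X j)) P =
      ∑ j, w j * covariance U (fun ω => (Z ω : C(D, ℝ)) (X j)) P := by
  have := hZ.isProbabilityMeasure
  rw [covariance_fun_sum_right (fun j => (hZ.memLp_two (X j)).const_mul (w j)) hU]
  simp_rw [covariance_const_mul_right]

/-- Vectors in the kernel of the Gram matrix are orthogonal to every `𝐤(x)`: the corresponding
combination of the observations has variance zero, hence is uncorrelated with the whole field. -/
lemma kernelVec_dotProduct_eq_zero (hZ : IsGaussianField P Z m k) {v : Fin n → ℝ}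
    (hv : gramMat k X *ᵥ v = 0) (x : D) : kernelVec k X x ⬝ᵥ v = 0 := by
  have := hZ.isProbabilityMeasure
  set U : Ω → ℝ := fun ω => ∑ j, v j * (Z ω : C(D, ℝ)) (X j) with hU
  have hU2 : MemLp U 2 P := memLp_finsetSum _ fun j _ => (hZ.memLp_two (X j)).const_mul (v j)
  have hcov (x : D) : covariance (fun ω => (Z ω : C(D, ℝ)) x) U P = kernelVec k X x ⬝ᵥ v := by
    rw [hU, hZ.cov_sum_right X v (hZ.memLp_two x)]
    simp_rw [hZ.cov_eq, dotProduct, kernelVec, mul_comm]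
  have hvar : variance U P = 0 := by
    rw [← covariance_self hU2.aemeasurable]
    nth_rewrite 2 [hU]
    rw [hZ.cov_sum_right X v hU2]
    refine Finset.sum_eq_zero fun j _ => ?_
    rw [covariance_comm, hcov]
    exact mul_eq_zero_of_right _ (congrFun hv j)
  rw [← hcov, covariance]
  refine integral_eq_zero_of_ae ?_
  filter_upwards [ae_eq_integral_of_variance_eq_zero hU2 hvar] with ω hω
  simp [hω]

/-- Covariance of the kriging residual with the field. -/
lemma cov_residual_eval (hZ : IsGaussianField P Z m k) (X : Fin n → D)
    (A : Matrix (Fin n) (Fin n) ℝ) (x x' : D) :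
    covariance (fun ω => (Z ω : C(D, ℝ)) x - kernelVec k X x ⬝ᵥ (A *ᵥ obsVec Z X ω))
      (fun ω => (Z ω : C(D, ℝ)) x') P = k x x' - kernelVec k X x ⬝ᵥ (A *ᵥ kernelVec k X x') := by
  have := hZ.isProbabilityMeasure
  simp_rw [Matrix.dotProduct_mulVec]
  set w := kernelVec k X x ᵥ* A
  have hw : (fun ω => w ⬝ᵥ obsVec Z X ω) = fun ω => ∑ j, w j * (Z ω : C(D, ℝ)) (X j) := rfl
  have hU2 : MemLp (fun ω => w ⬝ᵥ obsVec Z X ω) 2 P :=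
    memLp_finsetSum _ fun j _ => (hZ.memLp_two (X j)).const_mul (w j)
  rw [covariance_fun_sub_left (hZ.memLp_two x) hU2 (hZ.memLp_two x'), hZ.cov_eq, covariance_comm,
    hw, hZ.cov_sum_right X w (hZ.memLp_two x')]
  simp_rw [hZ.cov_eq, dotProduct, kernelVec]

/-- For a generalized inverse `A` of the Gram matrix, the kriging residual is uncorrelated with
the observations. -/
lemma cov_residual_obs (hZ : IsGaussianField P Z m k) {A : Matrix (Fin n) (Fin n) ℝ}
    (hA : gramMat k X * A * gramMat k X = gramMat k X) (x : D) (j : Fin n) :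
    covariance (fun ω => (Z ω : C(D, ℝ)) x - kernelVec k X x ⬝ᵥ (A *ᵥ obsVec Z X ω))
      (fun ω => (Z ω : C(D, ℝ)) (X j)) P = 0 := by
  rw [hZ.cov_residual_eval]
  have hj : kernelVec k X (X j) = gramMat k X *ᵥ Pi.single j 1 := by
    ext i
    simp [kernelVec, gramMat, hZ.cov_comm (X j)]
  have hv : gramMat k X *ᵥ (Pi.single j 1 - A *ᵥ kernelVec k X (X j)) = 0 := by
    rw [Matrix.mulVec_sub, hj, Matrix.mulVec_mulVec, Matrix.mulVec_mulVec, hA, sub_self]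
  have := hZ.kernelVec_dotProduct_eq_zero hv x
  rw [dotProduct_sub, dotProduct_single, mul_one] at this
  exact this

/-- The kriging residual and the observations are jointly Gaussian. -/
lemma isGaussianProcess_residual (hZ : IsGaussianField P Z m k) (X : Fin n → D)
    (A : Matrix (Fin n) (Fin n) ℝ) :
    IsGaussianProcess (Sum.elim
      (fun (x : D) ω => (Z ω : C(D, ℝ)) x - kernelVec k X x ⬝ᵥ (A *ᵥ obsVec Z X ω))
      (fun (j : Fin n) ω => (Z ω : C(D, ℝ)) (X j))) P := by
  classical
  refine hZ.gaussian.of_isGaussianProcess ?_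
  rintro (x | j)
  · refine ⟨insert x (Finset.univ.image X),
      ContinuousLinearMap.proj (R := ℝ) (φ := fun _ => ℝ) ⟨x, by simp⟩ -
        ∑ j, (kernelVec k X x ᵥ* A) j •
          ContinuousLinearMap.proj (R := ℝ) (φ := fun _ => ℝ) ⟨X j, by simp⟩, fun ω => ?_⟩
    simpa [dotProduct, obsVec] using
      Matrix.dotProduct_mulVec (kernelVec k X x) A (obsVec Z X ω)
  · exact ⟨{X j}, ContinuousLinearMap.proj (R := ℝ) (φ := fun _ => ℝ) ⟨X j, by simp⟩,
      fun ω => by simp⟩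

/-- The kriging residual `Z - 𝐤ᵗ A Z(X)` is independent of the observations, as a random path. -/
lemma indepFun_residual_obsVec (hZ : IsGaussianField P Z m k) {A : Matrix (Fin n) (Fin n) ℝ}
    (hA : gramMat k X * A * gramMat k X = gramMat k X) {g : Fin n → B}
    (hg : ∀ i x, (g i : C(D, ℝ)) x = k x (X i)) :
    IndepFun (fun ω => Z ω - krigingPath g A (obsVec Z X ω)) (obsVec Z X) P := by
  have hGP := hZ.isGaussianProcess_residual X A
  have h := hGP.indepFun_of_covariance_eq_zero (fun x => hGP.aemeasurable (.inl x))
    (fun j => hGP.aemeasurable (.inr j)) (hZ.cov_residual_obs hA)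
  have hR : (fun (ω : Ω) (x : D) => ((Z ω - krigingPath g A (obsVec Z X ω) : B) : C(D, ℝ)) x) =
      fun ω x => (Z ω : C(D, ℝ)) x - kernelVec k X x ⬝ᵥ (A *ᵥ obsVec Z X ω) := by
    ext ω x
    simp [krigingPath_apply A hg]
  rw [← hR] at h
  rw [IndepFun_iff_Indep] at h ⊢
  convert! h using 1
  rw [pathMeasurableSpace, MeasurableSpace.comap_comp]
  rfl

lemma measurable_residual (hZ : IsGaussianField P Z m k) (X : Fin n → D) (g : Fin n → B)
    (A : Matrix (Fin n) (Fin n) ℝ) :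
    Measurable fun ω => Z ω - krigingPath g A (obsVec Z X ω) := by
  refine measurable_path_iff.2 fun x => (hZ.measurable_eval x).sub ?_
  exact (measurable_pathEval x).comp
    ((measurable_krigingPath g A).comp (hZ.measurable_obsVec X))

/-- The kriging residual is a centred Gaussian field whose covariance is the conditional
covariance kernel. -/
lemma residual (hZ : IsGaussianField P Z (fun _ => 0) k) (hK : IsUnit (gramMat k X).det)
    {g : Fin n → B} (hg : ∀ i x, (g i : C(D, ℝ)) x = k x (X i)) :
    IsGaussianField P (fun ω => Z ω - krigingPath g (gramMat k X)⁻¹ (obsVec Z X ω)) (fun _ => 0)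
      (gprCov k X) := by
  have := hZ.isProbabilityMeasure
  set A := (gramMat k X)⁻¹ with hAdef
  have hA : gramMat k X * A * gramMat k X = gramMat k X := by
    rw [Matrix.mul_nonsing_inv _ hK, one_mul]
  have hR (ω : Ω) (x : D) : ((Z ω - krigingPath g A (obsVec Z X ω) : B) : C(D, ℝ)) x =
      (Z ω : C(D, ℝ)) x - kernelVec k X x ⬝ᵥ (A *ᵥ obsVec Z X ω) := by
    simp [krigingPath_apply A hg]
  have hGP := (hZ.isGaussianProcess_residual X A).comp_right Sum.inl
  refine ⟨hZ.measurable_residual X g A, ?_, fun x => ?_, fun x x' => ?_⟩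
  · simp_rw [hR]
    exact hGP
  · simp_rw [hR, Matrix.dotProduct_mulVec, dotProduct, obsVec]
    rw [integral_sub (hZ.integrable x)
      (integrable_finsetSum _ fun j _ => (hZ.integrable (X j)).const_mul _),
      integral_finsetSum _ fun j _ => (hZ.integrable (X j)).const_mul _]
    simp [integral_const_mul, hZ.mean_eq]
  · simp_rw [hR]
    have hx : MemLp (fun ω => (Z ω : C(D, ℝ)) x - kernelVec k X x ⬝ᵥ (A *ᵥ obsVec Z X ω)) 2 P :=
      (hGP.hasGaussianLaw_eval x).memLp_two
    have hU2 : MemLp (fun ω => kernelVec k X x' ⬝ᵥ (A *ᵥ obsVec Z X ω)) 2 P := by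
      simp_rw [Matrix.dotProduct_mulVec]
      exact memLp_finsetSum _ fun j _ => (hZ.memLp_two (X j)).const_mul _
    rw [covariance_fun_sub_right hx (hZ.memLp_two x') hU2, hZ.cov_residual_eval]
    simp_rw [Matrix.dotProduct_mulVec (kernelVec k X x') A]
    have h0 := hZ.cov_sum_right X (kernelVec k X x' ᵥ* A) hx
    simp_rw [hZ.cov_residual_obs hA, mul_zero, Finset.sum_const_zero] at h0
    refine (congrArg _ h0).trans (sub_zero _)

end IsGaussianField

end Kriging

/-! ### A zero-one argument -/

section ZeroOne

/-- A random variable that is independent of itself and has a symmetric law vanishes almost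
surely: `{U < 0}` and `{0 < U}` are disjoint, equally likely, and of probability zero or one. -/
lemma ae_eq_zero_of_indepFun_self_of_symm {Ω : Type*} [MeasurableSpace Ω] {P : Measure Ω}
    [IsProbabilityMeasure P] {U : Ω → ℝ} (hU : Measurable U) (hind : IndepFun U U P)
    (hsymm : P.map (fun ω => -U ω) = P.map U) : ∀ᵐ ω ∂P, U ω = 0 := by
  have hneg : MeasurableSet {ω | U ω < 0} := measurableSet_lt hU measurable_const
  have hpos : MeasurableSet {ω | 0 < U ω} := measurableSet_lt measurable_const hU
  have heq : P {ω | 0 < U ω} = P {ω | U ω < 0} := by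
    have := congrArg (fun μ => μ (Set.Iio 0)) hsymm
    simp only [Measure.map_apply hU.fun_neg measurableSet_Iio,
      Measure.map_apply hU measurableSet_Iio] at this
    simpa [Set.preimage] using this
  have h01 : P {ω | U ω < 0} = 0 ∨ P {ω | U ω < 0} = 1 :=
    measure_eq_zero_or_one_of_indep_self ((IndepFun_iff_Indep _ _ _).1 hind)
      ⟨Set.Iio 0, measurableSet_Iio, rfl⟩
  have hzero : P {ω | U ω < 0} = 0 := by
    refine h01.resolve_right fun h1 => ?_
    have hdisj : Disjoint {ω | U ω < 0} {ω | 0 < U ω} :=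
      Set.disjoint_left.2 fun ω (h : U ω < 0) (h' : 0 < U ω) => lt_asymm h h'
    have hle := prob_le_one (μ := P) (s := {ω | U ω < 0} ∪ {ω | 0 < U ω})
    rw [measure_union hdisj hpos, heq, h1] at hle
    norm_num at hle
  rw [ae_iff]
  have hset : {ω | ¬ U ω = 0} = {ω | U ω < 0} ∪ {ω | 0 < U ω} := by
    ext ω
    exact lt_or_lt_iff_ne.symm
  rw [hset]
  exact measure_union_null hzero (heq.trans hzero)

end ZeroOne

/-! ### Invariance of Gaussian fields -/

section Invariance

variable {d : ℕ} {D : Set (EuclideanSpace ℝ (Fin d))} {B : Submodule ℝ C(D, ℝ)}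
  {Ω : Type*} [MeasurableSpace Ω] {P : Measure Ω} {Z : Ω → B} {k : D → D → ℝ}

/-- A measurable linear functional on the path space that vanishes at the functions `k(x, ·)` is
independent of finitely many values of the field: it takes the same value at the path and at its
kriging residual. -/
lemma IsGaussianField.indepFun_linear_obsVec {m : D → ℝ} (hZ : IsGaussianField P Z m k)
    {ℓ : B →ₗ[ℝ] ℝ} (hℓ : Measurable ℓ) {g : D → B} (hg : ∀ x x', (g x : C(D, ℝ)) x' = k x x')
    (h0 : ∀ x, ℓ (g x) = 0) {n : ℕ} (X : Fin n → D) :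
    IndepFun (fun ω => ℓ (Z ω)) (obsVec Z X) P := by
  obtain ⟨A, hA⟩ := (gramMat k X).exists_mul_mul_eq_self
  have h := hZ.indepFun_residual_obsVec hA (g := fun i => g (X i))
    fun i x => (hg _ _).trans (hZ.cov_comm _ _)
  have hM (y : Fin n → ℝ) : ℓ (krigingPath (fun i => g (X i)) A y) = 0 := by
    simp [krigingPath, Fintype.linearCombination_apply, h0]
  simpa [Function.comp_def, hM] using! h.comp hℓ measurable_id

/-- **Zero-one law for linear functionals of a Gaussian field.** A measurable linear functional on
the path space that vanishes at the functions `k(x, ·)` vanishes at almost every path. -/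
theorem IsGaussianField.ae_linear_eq_zero (hZ : IsGaussianField P Z (fun _ => 0) k)
    {ℓ : B →ₗ[ℝ] ℝ} (hℓ : Measurable ℓ) {g : D → B} (hg : ∀ x x', (g x : C(D, ℝ)) x' = k x x')
    (h0 : ∀ x, ℓ (g x) = 0) : ∀ᵐ ω ∂P, ℓ (Z ω) = 0 := by
  have := hZ.isProbabilityMeasure
  have hU : Measurable fun ω => ℓ (Z ω) := hℓ.comp hZ.measurable
  have hproc : IndepFun (fun ω => ℓ (Z ω)) (fun ω (x : D) => (Z ω : C(D, ℝ)) x) P := by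
    refine IndepFun.indepFun_process hU hZ.measurable_eval fun I => ?_
    have h := hZ.indepFun_linear_obsVec hℓ hg h0 (fun i => (I.equivFin.symm i : D))
    have h' := h.comp measurable_id
      (measurable_pi_iff.2 fun i : I => measurable_pi_apply (I.equivFin i))
    simpa [Function.comp_def, obsVec] using! h'
  have hpath : IndepFun (fun ω => ℓ (Z ω)) Z P := by
    rw [IndepFun_iff_Indep] at hproc ⊢
    convert! hproc using 1
    rw [pathMeasurableSpace, MeasurableSpace.comap_comp]
    rfl
  refine ae_eq_zero_of_indepFun_self_of_symm hU (hpath.comp measurable_id hℓ) ?_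
  have hs := congrArg (Measure.map ℓ) hZ.map_neg_eq
  rw [Measure.map_map hℓ hZ.measurable, Measure.map_map hℓ] at hs
  · simpa [Function.comp_def] using hs
  · exact measurable_path_iff.2 fun x => (hZ.measurable_eval x).neg

/-- A Gaussian field is invariant if its mean function and its covariance kernel are. -/
theorem IsGaussianField.isInvariantField {m : D → ℝ} (hZ : IsGaussianField P Z m k)
    {T : B →ₗ[ℝ] (D → ℝ)} (hT : ∀ x : D, Measurable (fun f : B => T f x))
    (hm : IsInvariantFun T m) (hk : IsArgInvariant T k) : IsInvariantField T P Z := by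
  intro x
  obtain ⟨μ, hμ, hTμ⟩ := hm
  choose g hg hTg using hk
  let ℓ : B →ₗ[ℝ] ℝ :=
    { toFun := fun f => T f x - (f : C(D, ℝ)) x
      map_add' := fun f f' => by simp; ring
      map_smul' := fun c f => by simp; ring }
  have hZ' : IsGaussianField P (fun ω => Z ω + -μ) (fun _ => 0) k := by
    convert! hZ.add_const (-μ) using 2 with x
    simp [hμ]
  have h := hZ'.ae_linear_eq_zero (ℓ := ℓ) ((hT x).sub (measurable_pathEval x)) hg fun y => by
    simp [ℓ, hTg, hg]
  filter_upwards [h] with ω hω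
  simp only [ℓ, LinearMap.coe_mk, AddHom.coe_mk, map_add, map_neg, hTμ] at hω
  simp [hμ] at hω
  linarith

end Invariance

/-! ### Conditional distributions -/

section Conditional

/-- Freezing: if `R` is independent of `Y`, then the laws of `φ y R` form a conditional distribution
of `φ Y R` given `Y`. -/
lemma exists_hasCondDistrib_of_indepFun {Ω E F : Type*} [MeasurableSpace Ω] [MeasurableSpace E]
    [MeasurableSpace F] {P : Measure Ω} [IsProbabilityMeasure P] {R : Ω → E} {Y : Ω → F}
    (hR : Measurable R) (hY : Measurable Y) (h : IndepFun R Y P) {φ : F → E → E}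
    (hφ : Measurable fun p : F × E => φ p.1 p.2) :
    ∃ κ : Kernel F E, IsMarkovKernel κ ∧ HasCondDistrib (fun ω => φ (Y ω) (R ω)) Y κ P ∧
      ∀ y, κ y = P.map fun ω => φ y (R ω) := by
  have := Measure.isProbabilityMeasure_map (μ := P) hR.aemeasurable
  have := Measure.isProbabilityMeasure_map (μ := P) hY.aemeasurable
  let κ : Kernel F E := (Kernel.id ×ₖ Kernel.const F (P.map R)).map fun p => φ p.1 p.2
  have hφy (y : F) : Measurable (φ y) := hφ.comp measurable_prodMk_left
  have hκ (y : F) : κ y = P.map fun ω => φ y (R ω) := by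
    rw [Kernel.map_apply _ hφ, Kernel.prod_apply, Kernel.id_apply, Kernel.const_apply,
      Measure.dirac_prod, Measure.map_map hφ measurable_prodMk_left,
      Measure.map_map (hφ.comp measurable_prodMk_left) hR]
    rfl
  have hMarkov : IsMarkovKernel κ := Kernel.IsMarkovKernel.map _ hφ
  have hpair : Measurable fun ω => φ (Y ω) (R ω) := hφ.comp (hY.prodMk hR)
  refine ⟨κ, hMarkov, ⟨(hY.prodMk hpair).aemeasurable, ?_⟩, hκ⟩
  have hΨ : Measurable fun p : F × E => (p.1, φ p.1 p.2) := measurable_fst.prodMk hφ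
  have hprod := (indepFun_iff_map_prod_eq_prod_map_map hY.aemeasurable hR.aemeasurable).1 h.symm
  have hmap : P.map (fun ω => (Y ω, φ (Y ω) (R ω))) =
      ((P.map Y).prod (P.map R)).map fun p : F × E => (p.1, φ p.1 p.2) := by
    rw [← hprod, Measure.map_map hΨ (hY.prodMk hR)]
    rfl
  rw [hmap]
  ext s hs
  rw [Measure.compProd_apply hs, Measure.map_apply hΨ hs, Measure.prod_apply (hΨ hs)]
  refine lintegral_congr fun y => ?_
  rw [hκ, ← Function.comp_def (φ y) R, ← Measure.map_map (hφy y) hR,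
    Measure.map_apply (hφy y) (measurable_prodMk_left hs)]
  rfl

end Conditional

/-! ### Invariance of Gaussian process regression -/

theorem mainTheorem5 {d : ℕ} (D : Set (EuclideanSpace ℝ (Fin d))) (hD : IsCompact D)
    -- the path space and the operator on the paths
    (B : Submodule ℝ C(D, ℝ)) (T : B →ₗ[ℝ] (D → ℝ))
    (hT : ∀ x : D, Measurable (fun f : B => T f x))
    -- the centred Gaussian field with argumentwise invariant kernel
    {Ω : Type*} [MeasurableSpace Ω] (P : Measure Ω) [IsProbabilityMeasure P]
    (Z : Ω → B) (k : D → D → ℝ) (hZ : IsGaussianField P Z (fun _ => 0) k)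
    (hk : IsArgInvariant T k)
    -- the observation points
    (n : ℕ) (X : Fin n → D) (hK : IsUnit (gramMat k X).det) :
    -- the predictor is invariant, for all observed values
    (∀ y : Fin n → ℝ, IsInvariantFun T (gprMean k X y)) ∧
    -- the conditional covariance kernel is argumentwise invariant
    IsArgInvariant T (gprCov k X) ∧
    -- there is a conditional distribution of the field given the observations, and it is, for all
    -- observed values, Gaussian with mean `m` and covariance `c` and invariant
    (∃ κ : Kernel (Fin n → ℝ) B, IsMarkovKernel κ ∧ HasCondDistrib Z (obsVec Z X) κ P ∧
      ∀ y : Fin n → ℝ, IsGaussianField (κ y) (fun f : B => f) (gprMean k X y) (gprCov k X) ∧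
        IsInvariantField T (κ y) (fun f : B => f)) ∧
    -- any version of the conditional distribution is invariant, for almost all observed values
    (∀ κ : Kernel (Fin n → ℝ) B, IsMarkovKernel κ → HasCondDistrib Z (obsVec Z X) κ P →
      ∀ᵐ y ∂(P.map (obsVec Z X)), IsInvariantField T (κ y) (fun f : B => f)) ∧
    -- every conditional simulation, on any probability space, is invariant
    (∀ (y : Fin n → ℝ) {Ω' : Type*} [MeasurableSpace Ω'] (P' : Measure Ω')
      [IsProbabilityMeasure P'] (W : Ω' → B),
      IsGaussianField P' W (gprMean k X y) (gprCov k X) → IsInvariantField T P' W) := by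
  have hk' := hk
  choose γ hγ hTγ using hk'
  have hg (i : Fin n) (x : D) : (γ (X i) : C(D, ℝ)) x = k x (X i) := by
    rw [hγ, hZ.cov_comm]
  set M := krigingPath (fun i => γ (X i)) (gramMat k X)⁻¹ with hMdef
  have hM (y : Fin n → ℝ) (x : D) : (M y : C(D, ℝ)) x = gprMean k X y x :=
    krigingPath_apply _ hg y x
  have hTM (y : Fin n → ℝ) : T (M y) = gprMean k X y := by
    ext x
    rw [← hM]
    simp [M, krigingPath, Fintype.linearCombination_apply, hTγ, hγ]
  have hmean (y : Fin n → ℝ) : IsInvariantFun T (gprMean k X y) := ⟨M y, hM y, hTM y⟩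
  have hcov : IsArgInvariant T (gprCov k X) := by
    -- By symmetry of the two kernels, `c(x, ·) = k(x, ·) - m_y` for the values `y = 𝐤(x)`.
    intro x
    have hc (x' : D) : gprCov k X x x' = k x x' - gprMean k X (kernelVec k X x) x' := by
      have hR := hZ.residual hK hg
      rw [hR.cov_comm x x', gprCov, gprMean, hZ.cov_comm x x']
    refine ⟨γ x - M (kernelVec k X x), fun x' => ?_, ?_⟩
    · simp [hc, hγ, hM]
    · ext x'
      simp [hc, hTγ, hTM]
  have hadd : Measurable fun p : (Fin n → ℝ) × B => p.2 + M p.1 :=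
    measurable_path_iff.2 fun x => ((measurable_pathEval x).comp measurable_snd).add
      ((measurable_pathEval x).comp ((measurable_krigingPath _ _).comp measurable_fst))
  obtain ⟨κ, hκM, hκ, hκy⟩ := exists_hasCondDistrib_of_indepFun
    (hZ.measurable_residual X (fun i => γ (X i)) (gramMat k X)⁻¹) (hZ.measurable_obsVec X)
    (hZ.indepFun_residual_obsVec (by rw [Matrix.mul_nonsing_inv _ hK, one_mul]) hg)
    (φ := fun y r => r + M y) hadd
  simp only [← hMdef, sub_add_cancel] at hκ
  have hκG (y : Fin n → ℝ) :
      IsGaussianField (κ y) (fun f : B => f) (gprMean k X y) (gprCov k X) := by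
    have h := (hZ.residual hK hg).add_const (M y)
    simp only [hM, zero_add] at h
    rw [hκy y]
    exact (IsGaussianField.map_iff h.measurable).2 h
  have hκinv (y : Fin n → ℝ) : IsInvariantField T (κ y) (fun f : B => f) :=
    (hκG y).isInvariantField hT (hmean y) hcov
  refine ⟨hmean, hcov, ⟨κ, hκM, hκ, fun y => ⟨hκG y, hκinv y⟩⟩, fun η hη hηZ => ?_,
    fun y _ _ P' _ W hW => hW.isInvariantField hT (hmean y) hcov⟩
  have : IsProbabilityMeasure (P.map (obsVec Z X)) :=
    Measure.isProbabilityMeasure_map (hZ.measurable_obsVec X).aemeasurable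
  -- One null set serves all points of `D` at once: the path space is countably generated, so two
  -- conditional distributions agree for almost every `y`.
  filter_upwards [Kernel.ae_eq_of_compProd_eq (hηZ.map_eq.symm.trans hκ.map_eq)] with y hy
  rw [hy]
  exact hκinv y
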